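/- **Definitions.** $e$ denotes a column vector of ones of suitable length and $I$ an identity matrix. A real square matrix $T$ is a *sub-intensity matrix* if its off-diagonal entries are nonnegative, its exit vector $t=-Te$ is nonnegative, and every state is transient (from each state some state with positive exit rate can be reached along positive entries of $T$); $(\pi,T)$ is a *phase-type representation* if moreover $\pi$ is a probability row vector. For $0<\alpha\le 1$, a random variable $Y\ge 0$ has the matrix Mittag-Leffler distribution $\mathrm{MML}(\alpha,\pi,T)$, where $(\pi,T)$ is a phase-type representation, if $\mathbb E(e^{-uY})=\pi(u^{\alpha}I-T)^{-1}t$ for all $u\ge 0$. For $\alpha=(\alpha_1,\dots,\alpha_n)\in(0,1]^n$, a phase-type representation $(\beta,T)$ of dimension $m$ and a nonnegative $m\times n$ matrix $R$, a random vector $X$ with values in $\mathbb R_+^n$ has the distribution $\mathrm{GMML}(\alpha,\beta,T,R)$ if $\mathbb E(e^{-\langle u,X\rangle})=\beta(\Delta(Ru^{\alpha})-T)^{-1}t$ for all $u\in\mathbb R_+^n$, where $u^\alpha=(u_1^{\alpha_1},\dots,u_n^{\alpha_n})$ and $\Delta(v)$ is the diagonal matrix with diagonal $v$. For a square matrix $A$,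 $E_{\alpha,\beta}(A)=\sum_{k\ge 0}A^k/\Gamma(\alpha k+\beta)$. **Setting.** Let $n\ge 1$ and $\alpha_1,\dots,\alpha_n\in(0,1]$. Let $C_i$ ($i=1,\dots,n$) be a $p_i\times p_i$ sub-intensity matrix and $D_i$ a nonnegative $p_i\times p_{i+1}$ matrix ($p_{n+1}$ being arbitrary) with $-C_ie=D_ie$, and let $\pi$ be a probability row vector of length $p_1$. Put $$\beta=(\pi,0,\dots,0),\qquad T=\begin{pmatrix} C_1&D_1&0&\cdots&0\\ 0&C_2&D_2&\cdots&0\\ \vdots&&\ddots&\ddots&\vdots\\ 0&0&0&\cdots&C_n\end{pmatrix},\qquad R=\begin{pmatrix} e&0&\cdots&0\\ 0&e&\cdots&0\\ \vdots&&\ddots&\vdots\\ 0&0&\cdots&e\end{pmatrix}.$$ All products below are ordered, $\prod_{i=1}^nA_i=A_1A_2\cdots A_n$. **Theorem.** (i) For every $u\in\mathbb R_+^n$ the inverses below exist and $$\beta(\Delta(Ru^{\alpha})-T)^{-1}(-Te)=\beta\begin{pmatrix} u_1^{\alpha_1}I-C_1&-D_1&\cdots&0\\ 0&u_2^{\alpha_2}I-C_2&\cdots&0\\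 \vdots&&\ddots&\vdots\\ 0&0&\cdots&u_n^{\alpha_n}I-C_n\end{pmatrix}^{-1}\begin{pmatrix}0\\ \vdots\\ 0\\ D_ne\end{pmatrix}=\pi\Big(\prod_{i=1}^n(u_i^{\alpha_i}I-C_i)^{-1}D_i\Big)e .$$ Now let $X=(X_1,\dots,X_n)\sim\mathrm{GMML}(\alpha,\beta,T,R)$. Then: (ii) $\mathbb E(e^{-\langle u,X\rangle})=\pi\big(\prod_{i=1}^n(u_i^{\alpha_i}I-C_i)^{-1}D_i\big)e$ for all $u\in\mathbb R_+^n$. (iii) $X$ takes values in $(0,\infty)^n$ almost surely, and its law has there the (nonnegative) Lebesgue density $$f_X(x_1,\dots,x_n)=\pi\Big(\prod_{i=1}^n x_i^{\alpha_i-1}E_{\alpha_i,\alpha_i}(C_ix_i^{\alpha_i})D_i\Big)e,\qquad x_i>0 .$$ (iv) For every $i$, $X_i\sim\mathrm{MML}(\alpha_i,\beta_i,C_i)$ with $\beta_i=\pi\prod_{j=1}^{i-1}(-C_j)^{-1}D_j$; in particular $(\beta_i,C_i)$ is a phase-type representation. -/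

import Mathlib

noncomputable section

namespace GMMLPaper

open MeasureTheory

/-- The exit (column) vector `t = -T e` of a matrix `T`. -/
def exitVec {ι : Type*} [Fintype ι] (T : Matrix ι ι ℝ) : ι → ℝ :=
  -(T.mulVec 1)

/-- `T` is a sub-intensity matrix: the restriction of the intensity matrix of a finite Markov jump
process with one absorbing state to the other states, all of which are transient, that is, from each
of which some state with a positive exit rate (and hence the absorbing state) can be reached. -/
structure IsSubIntensity {ι : Type*} [Fintype ι] (T : Matrix ι ι ℝ) : Prop where
  offDiag_nonneg : ∀ i j, i ≠ j → 0 ≤ T i j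
  exit_nonneg : ∀ i, 0 ≤ exitVec T i
  transient : ∀ i, ∃ j, Relation.ReflTransGen (fun a b => 0 < T a b) i j ∧ 0 < exitVec T j

/-- `(π, T)` is a phase-type representation: `π` is a probability vector on the transient states
and `T` is a sub-intensity matrix. -/
structure IsPhaseTypeRep {ι : Type*} [Fintype ι] (π : ι → ℝ) (T : Matrix ι ι ℝ) : Prop where
  init_nonneg : ∀ i, 0 ≤ π i
  init_sum : ∑ i, π i = 1
  subIntensity : IsSubIntensity T

/-- The Mittag-Leffler function of a square matrix,
`E_{α,β}(A) = ∑_{k ≥ 0} A ^ k / Γ(α k + β)`. -/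
def mittagLeffler {ι : Type*} [Fintype ι] [DecidableEq ι] (α β : ℝ) (A : Matrix ι ι ℝ) :
    Matrix ι ι ℝ :=
  ∑' k : ℕ, (Real.Gamma (α * k + β))⁻¹ • A ^ k

/-- The nonnegative random variable `Y` has the matrix Mittag-Leffler distribution
`MML(α, π, T)`: its Laplace transform is `u ↦ π (u ^ α I - T)⁻¹ t`, `u ≥ 0`. -/
structure IsMML {ι : Type*} [Fintype ι] [DecidableEq ι] {Ω : Type*} [MeasurableSpace Ω]
    (α : ℝ) (π : ι → ℝ) (T : Matrix ι ι ℝ) (Y : Ω → ℝ) (P : Measure Ω) : Prop where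
  alpha_pos : 0 < α
  alpha_le_one : α ≤ 1
  rep : IsPhaseTypeRep π T
  aemeasurable : AEMeasurable Y P
  nonneg : ∀ᵐ ω ∂P, 0 ≤ Y ω
  laplace : ∀ u : ℝ, 0 ≤ u →
    ∫ ω, Real.exp (-(u * Y ω)) ∂P =
      π ⬝ᵥ ((u ^ α • (1 : Matrix ι ι ℝ) - T)⁻¹.mulVec (exitVec T))

/-- The function `φ(u) = π (Δ(R u^α) - T)⁻¹ t`, where `u^α = (u₁^α₁, …, uₙ^αₙ)`. -/
def gmmlLaplace {ι : Type*} [Fintype ι] [DecidableEq ι] {n : ℕ}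
    (α : Fin n → ℝ) (π : ι → ℝ) (T : Matrix ι ι ℝ) (R : Matrix ι (Fin n) ℝ) (u : Fin n → ℝ) : ℝ :=
  π ⬝ᵥ ((Matrix.diagonal (R.mulVec fun k => u k ^ α k) - T)⁻¹.mulVec (exitVec T))

/-- The nonnegative random vector `X` has the multivariate generalized matrix Mittag-Leffler
distribution `GMML(α, π, T, R)`. -/
structure IsGMML {ι : Type*} [Fintype ι] [DecidableEq ι] {n : ℕ} {Ω : Type*} [MeasurableSpace Ω]
    (α : Fin n → ℝ) (π : ι → ℝ) (T : Matrix ι ι ℝ) (R : Matrix ι (Fin n) ℝ)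
    (X : Ω → Fin n → ℝ) (P : Measure Ω) : Prop where
  alpha_pos : ∀ k, 0 < α k
  alpha_le_one : ∀ k, α k ≤ 1
  rep : IsPhaseTypeRep π T
  reward_nonneg : ∀ i k, 0 ≤ R i k
  aemeasurable : AEMeasurable X P
  nonneg : ∀ᵐ ω ∂P, ∀ k, 0 ≤ X ω k
  laplace : ∀ u : Fin n → ℝ, (∀ k, 0 ≤ u k) →
    ∫ ω, Real.exp (-∑ k, u k * X ω k) ∂P = gmmlLaplace α π T R u

section FeedForward

variable {n : ℕ} {p : Fin (n + 1) → ℕ}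

/-- The ordered product `A₁ A₂ ⋯ A_k` of rectangular matrices of compatible dimensions. -/
def chainProd (A : ∀ i : Fin n, Matrix (Fin (p i.castSucc)) (Fin (p i.succ)) ℝ) :
    ∀ k : Fin (n + 1), Matrix (Fin (p 0)) (Fin (p k)) ℝ :=
  fun k => Fin.induction (motive := fun k => Matrix (Fin (p 0)) (Fin (p k)) ℝ)
    1 (fun i M => M * A i) k

/-- The standing conditions on the data `(C_i, D_i)` and `π` of a feed-forward structure. The block
`C_i` has `p_i` rows and columns, and `D_i` has `p_i` rows and `p_{i+1}` columns; the number of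
columns of the last `D_i` is arbitrary. -/
structure IsFeedForward (C : ∀ i : Fin n, Matrix (Fin (p i.castSucc)) (Fin (p i.castSucc)) ℝ)
    (D : ∀ i : Fin n, Matrix (Fin (p i.castSucc)) (Fin (p i.succ)) ℝ)
    (π : Fin (p 0) → ℝ) : Prop where
  init_nonneg : ∀ a, 0 ≤ π a
  init_sum : ∑ a, π a = 1
  subIntensity : ∀ i, IsSubIntensity (C i)
  nonneg : ∀ i a b, 0 ≤ D i a b
  exit_eq : ∀ i, -((C i).mulVec 1) = (D i).mulVec 1

/-- The initial vector `β = (π, 0, …, 0)` of the block structure. -/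
def ffInit (π : Fin (p 0) → ℝ) : (Σ i : Fin n, Fin (p i.castSucc)) → ℝ :=
  fun x => if h : x.1.castSucc = 0 then π (Fin.cast (congrArg p h) x.2) else 0

/-- The block matrix with diagonal blocks `C_i`, blocks `D_i` immediately to the right of them
(for `i < n`) and zeros elsewhere. -/
def ffMatrix (C : ∀ i : Fin n, Matrix (Fin (p i.castSucc)) (Fin (p i.castSucc)) ℝ)
    (D : ∀ i : Fin n, Matrix (Fin (p i.castSucc)) (Fin (p i.succ)) ℝ) :
    Matrix (Σ i : Fin n, Fin (p i.castSucc)) (Σ i : Fin n, Fin (p i.castSucc)) ℝ :=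
  fun x y =>
    if h : y.1 = x.1 then
      C x.1 x.2 (Fin.cast (congrArg (fun i : Fin n => p i.castSucc) h) y.2)
    else if h : y.1.castSucc = x.1.succ then D x.1 x.2 (Fin.cast (congrArg p h) y.2)
    else 0

/-- The block-diagonal reward matrix, with columns of ones as its diagonal blocks. -/
def ffReward (p : Fin (n + 1) → ℕ) : Matrix (Σ i : Fin n, Fin (p i.castSucc)) (Fin n) ℝ :=
  fun x k => if x.1 = k then 1 else 0

/-- The vector `(0, …, 0, D_n e)`. -/
def ffExit (D : ∀ i : Fin n, Matrix (Fin (p i.castSucc)) (Fin (p i.succ)) ℝ) :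
    (Σ i : Fin n, Fin (p i.castSucc)) → ℝ :=
  fun x => if x.1.succ = Fin.last n then (D x.1).mulVec 1 x.2 else 0

/-- The block matrix with diagonal blocks `u_i ^ α_i I - C_i`, blocks `-D_i` immediately to the
right of them and zeros elsewhere. -/
def ffResolvent (α : Fin n → ℝ)
    (C : ∀ i : Fin n, Matrix (Fin (p i.castSucc)) (Fin (p i.castSucc)) ℝ)
    (D : ∀ i : Fin n, Matrix (Fin (p i.castSucc)) (Fin (p i.succ)) ℝ) (u : Fin n → ℝ) :
    Matrix (Σ i : Fin n, Fin (p i.castSucc)) (Σ i : Fin n, Fin (p i.castSucc)) ℝ :=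
  ffMatrix (fun i => u i ^ α i • 1 - C i) (fun i => -D i)

/-- The product `π (∏ (u_i ^ α_i I - C_i)⁻¹ D_i) e`. -/
def productLaplace (α : Fin n → ℝ)
    (C : ∀ i : Fin n, Matrix (Fin (p i.castSucc)) (Fin (p i.castSucc)) ℝ)
    (D : ∀ i : Fin n, Matrix (Fin (p i.castSucc)) (Fin (p i.succ)) ℝ)
    (π : Fin (p 0) → ℝ) (u : Fin n → ℝ) : ℝ :=
  π ⬝ᵥ ((chainProd (fun i => (u i ^ α i • 1 - C i)⁻¹ * D i) (Fin.last n)).mulVec 1)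

/-- The function `f(x) = π (∏ x_i ^ (α_i - 1) E_{α_i,α_i}(C_i x_i ^ α_i) D_i) e`. -/
def productDensity (α : Fin n → ℝ)
    (C : ∀ i : Fin n, Matrix (Fin (p i.castSucc)) (Fin (p i.castSucc)) ℝ)
    (D : ∀ i : Fin n, Matrix (Fin (p i.castSucc)) (Fin (p i.succ)) ℝ)
    (π : Fin (p 0) → ℝ) (x : Fin n → ℝ) : ℝ :=
  π ⬝ᵥ ((chainProd (fun i =>
    x i ^ (α i - 1) • (mittagLeffler (α i) (α i) (x i ^ α i • C i) * D i)) (Fin.last n)).mulVec 1)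

/-- The vector `β_i = π ∏_{j < i} (-C_j)⁻¹ D_j`. -/
def marginalInit (C : ∀ i : Fin n, Matrix (Fin (p i.castSucc)) (Fin (p i.castSucc)) ℝ)
    (D : ∀ i : Fin n, Matrix (Fin (p i.castSucc)) (Fin (p i.succ)) ℝ)
    (π : Fin (p 0) → ℝ) (i : Fin n) : Fin (p i.castSucc) → ℝ :=
  Matrix.vecMul π (chainProd (fun j => (-C j)⁻¹ * D j) i.castSucc)

end FeedForward

/-- `X` takes values in `(0, ∞)^n` almost surely and has density `f` there with respect to Lebesgue
measure. -/
structure HasPositiveDensity {n : ℕ} {Ω : Type*} [MeasurableSpace Ω]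
    (f : (Fin n → ℝ) → ℝ) (X : Ω → Fin n → ℝ) (P : Measure Ω) : Prop where
  aemeasurable : AEMeasurable X P
  aemeasurable_density : AEMeasurable f (volume.restrict {x : Fin n → ℝ | ∀ k, 0 < x k})
  nonneg : ∀ x : Fin n → ℝ, (∀ k, 0 < x k) → 0 ≤ f x
  map_eq : P.map X =
    (volume.restrict {x : Fin n → ℝ | ∀ k, 0 < x k}).withDensity fun x => ENNReal.ofReal (f x)

end GMMLPaper

end

open GMMLPaper

open GMMLPaper

/-! For a sub-intensity matrix `T` and s ≥ 0, the minimum principle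
`IsSubIntensity.nonneg_of_mulVec_nonneg` makes sI − T invertible with nonnegative inverse. The block
resolvent is upper bidiagonal, so its linear system is solved by back substitution, w_i = (u_i^{α_i}
I − C_i)⁻¹ D_i w_{i+1} with w_{n+1} = e; this produces the ordered product. As (−C_j)⁻¹ D_j e = e,
setting u_j = 0 for all j ≠ i collapses the product to the transform of a matrix Mittag-Leffler law.

For the density, gamma integrals match the series of x^{α−1} E_{α,α}(C x^α) termwise with the
Neumann series of (u^α I − C)⁻¹ (`mlKernel_laplace`). Expanding the matrix product over paths of
indices separates the variables, so Fubini gives the transform of f (`productDensity_laplace`). This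
works only for large u, and the sign of f is not yet known. Both gaps are closed in
`tilted_eq_of_laplace` and `density_of_laplace`: weight everything by exp(−⟨v,x⟩) with v large, move
the negative part of the weighted f to the side of the law, and compare two finite measures by
uniqueness of Laplace transforms (`ext_of_laplace`, a Stone–Weierstrass argument). The open set
where f < 0 is then null, hence empty, and the weight is divided out. The resulting identity of
measures also shows that the law charges only the open orthant. -/

namespace GMMLPaper
open Matrix

/-! ### Resolvents of sub-intensity matrices -/

section SubIntensity
variable {ι : Type*} [Fintype ι] {T : Matrix ι ι ℝ}

/-- A minimum principle for sub-intensity matrices. -/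
lemma IsSubIntensity.nonneg_of_mulVec_nonneg [DecidableEq ι] (hT : IsSubIntensity T) {s : ℝ}
    (hs : 0 ≤ s) {v : ι → ℝ} (hv : ∀ i, 0 ≤ ((s • (1 : Matrix ι ι ℝ) - T) *ᵥ v) i) (i : ι) :
    0 ≤ v i := by
  by_contra! hi
  obtain ⟨m, -, hm⟩ := Finset.exists_min_image Finset.univ v ⟨i, Finset.mem_univ i⟩
  have hm' : ∀ j, v m ≤ v j := fun j => hm j (Finset.mem_univ j)
  have hneg : v m < 0 := (hm' i).trans_lt hi
  -- At a negative minimum, row `a` of (sI − T)v is a sum of three nonpositive terms, yet it is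
  -- nonnegative; so each term vanishes.
  have key : ∀ a, v a = v m → exitVec T a = 0 ∧ ∀ b, 0 < T a b → v b = v m := by
    intro a ha
    have h := hv a
    have e : ((s • (1 : Matrix ι ι ℝ) - T) *ᵥ v) a =
        s * v m + v m * exitVec T a - ∑ b, T a b * (v b - v m) := by
      rw [sub_mulVec, smul_mulVec, one_mulVec]
      simp only [exitVec, mulVec, dotProduct, mul_sub,
        Finset.sum_sub_distrib, ← Finset.sum_mul, ha, Pi.sub_apply, Pi.smul_apply, smul_eq_mul,
        Pi.neg_apply, Pi.one_apply, mul_one]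
      ring
    have hterm : ∀ b, 0 ≤ T a b * (v b - v m) := by
      intro b
      by_cases hb : a = b
      · subst hb; simp [ha]
      · exact mul_nonneg (hT.offDiag_nonneg a b hb) (sub_nonneg.2 (hm' b))
    have hsum : 0 ≤ ∑ b, T a b * (v b - v m) := Finset.sum_nonneg fun b _ => hterm b
    have h1 := hT.exit_nonneg a
    have h2 : v m * exitVec T a ≤ 0 := mul_nonpos_of_nonpos_of_nonneg hneg.le h1
    have h3 : s * v m ≤ 0 := mul_nonpos_of_nonneg_of_nonpos hs hneg.le
    constructor
    · have h4 : v m * exitVec T a = 0 := by linarith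
      exact (mul_eq_zero.1 h4).resolve_left hneg.ne
    · intro b hb
      have h4 : ∑ b, T a b * (v b - v m) = 0 := by linarith
      have h5 := (Finset.sum_eq_zero_iff_of_nonneg fun b _ => hterm b).1 h4 b (Finset.mem_univ b)
      exact sub_eq_zero.1 ((mul_eq_zero.1 h5).resolve_left hb.ne')
  -- The minimum propagates along positive entries to a state with positive exit rate, contradicting
  -- `key` there.
  obtain ⟨j, hj, hpos⟩ := hT.transient m
  have hall : ∀ j, Relation.ReflTransGen (fun a b => 0 < T a b) m j → v j = v m := by
    intro j hj
    induction hj with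
    | refl => rfl
    | tail _ hbc ih => exact (key _ ih).2 _ hbc
  exact hpos.ne' (key j (hall j hj)).1

variable [DecidableEq ι]

lemma IsSubIntensity.isUnit_resolvent (hT : IsSubIntensity T) {s : ℝ} (hs : 0 ≤ s) :
    IsUnit (s • (1 : Matrix ι ι ℝ) - T) := by
  rw [← mulVec_injective_iff_isUnit]
  intro v w hvw
  have hle : ∀ {v w : ι → ℝ}, (s • (1 : Matrix ι ι ℝ) - T) *ᵥ v = (s • (1 : Matrix ι ι ℝ) - T) *ᵥ w →
      v ≤ w := fun {v w} h i => by
    have := hT.nonneg_of_mulVec_nonneg hs (v := w - v) (fun i => by simp [mulVec_sub, h]) i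
    simpa using this
  exact le_antisymm (hle hvw) (hle hvw.symm)

/-- Each column of the inverse is mapped to a unit vector, so the minimum principle applies to it.
-/
lemma IsSubIntensity.resolvent_nonneg (hT : IsSubIntensity T) {s : ℝ} (hs : 0 ≤ s) (a b : ι) :
    0 ≤ (s • (1 : Matrix ι ι ℝ) - T)⁻¹ a b := by
  have hu := hT.isUnit_resolvent hs
  refine hT.nonneg_of_mulVec_nonneg hs (v := fun a => (s • (1 : Matrix ι ι ℝ) - T)⁻¹ a b) ?_ a
  intro i
  have h : ((s • (1 : Matrix ι ι ℝ) - T) *ᵥ fun a => (s • (1 : Matrix ι ι ℝ) - T)⁻¹ a b) i =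
      (1 : Matrix ι ι ℝ) i b :=
    congrFun₂ (mul_nonsing_inv _ ((isUnit_iff_isUnit_det _).1 hu)) i b
  rw [h, one_apply]
  split_ifs <;> norm_num

end SubIntensity

/-! ### Feed-forward block algebra: back substitution and marginals -/

section FeedForward
variable {n : ℕ} {p : Fin (n + 1) → ℕ}

lemma chainProd_zero (A : ∀ i : Fin n, Matrix (Fin (p i.castSucc)) (Fin (p i.succ)) ℝ) :
    chainProd A 0 = 1 := rfl

lemma chainProd_succ (A : ∀ i : Fin n, Matrix (Fin (p i.castSucc)) (Fin (p i.succ)) ℝ)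
    (i : Fin n) : chainProd A i.succ = chainProd A i.castSucc * A i := rfl

/-- A chain product telescopes along a backward recursion. -/
lemma chainProd_mulVec_of_recursion
    (A : ∀ i : Fin n, Matrix (Fin (p i.castSucc)) (Fin (p i.succ)) ℝ)
    (w : ∀ k : Fin (n + 1), Fin (p k) → ℝ) (hw : ∀ i, w i.castSucc = A i *ᵥ w i.succ)
    (k : Fin (n + 1)) : chainProd A k *ᵥ w k = w 0 := by
  induction k using Fin.induction with
  | zero => rw [chainProd_zero, one_mulVec]
  | succ i ih => rw [chainProd_succ, ← mulVec_mulVec, ← hw, ih]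

lemma exists_backward_recursion
    (A : ∀ i : Fin n, Matrix (Fin (p i.castSucc)) (Fin (p i.succ)) ℝ)
    (v : Fin (p (Fin.last n)) → ℝ) :
    ∃ w : ∀ k : Fin (n + 1), Fin (p k) → ℝ,
      w (Fin.last n) = v ∧ ∀ i, w i.castSucc = A i *ᵥ w i.succ :=
  ⟨Fin.reverseInduction (motive := fun k => Fin (p k) → ℝ) v fun i => (A i *ᵥ ·),
    Fin.reverseInduction_last .., fun _ => Fin.reverseInduction_castSucc ..⟩

lemma chainProd_congr {A B : ∀ i : Fin n, Matrix (Fin (p i.castSucc)) (Fin (p i.succ)) ℝ}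
    (k : Fin (n + 1)) (h : ∀ i : Fin n, i.castSucc < k → A i = B i) :
    chainProd A k = chainProd B k := by
  induction k using Fin.induction with
  | zero => rfl
  | succ i ih =>
    rw [chainProd_succ, chainProd_succ, h i Fin.castSucc_lt_succ,
      ih fun j hj => h j (hj.trans Fin.castSucc_lt_succ)]

lemma chainProd_nonneg {A : ∀ i : Fin n, Matrix (Fin (p i.castSucc)) (Fin (p i.succ)) ℝ}
    (h : ∀ i a b, 0 ≤ A i a b) (k : Fin (n + 1)) (a : Fin (p 0)) (b : Fin (p k)) :
    0 ≤ chainProd A k a b := by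
  induction k using Fin.induction with
  | zero => rw [chainProd_zero, one_apply]; split_ifs <;> norm_num
  | succ i ih =>
    rw [chainProd_succ, mul_apply]
    exact Finset.sum_nonneg fun j _ => mul_nonneg (ih j) (h i j b)

/-- The action of a block matrix of feed-forward shape. -/
lemma ffMatrix_mulVec (A : ∀ i : Fin n, Matrix (Fin (p i.castSucc)) (Fin (p i.castSucc)) ℝ)
    (B : ∀ i : Fin n, Matrix (Fin (p i.castSucc)) (Fin (p i.succ)) ℝ)
    (w : ∀ k : Fin (n + 1), Fin (p k) → ℝ) (i : Fin n) (a : Fin (p i.castSucc)) :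
    (ffMatrix A B *ᵥ fun x => w x.1.castSucc x.2) ⟨i, a⟩ =
      (A i *ᵥ w i.castSucc) a + if i.succ = Fin.last n then 0 else (B i *ᵥ w i.succ) a := by
  rw [mulVec, dotProduct, Fintype.sum_sigma]
  have hblock : ∀ j : Fin n, ∑ b, ffMatrix A B ⟨i, a⟩ ⟨j, b⟩ * w j.castSucc b =
      (if j = i then (A i *ᵥ w i.castSucc) a else 0) +
        if j.castSucc = i.succ then (B i *ᵥ w i.succ) a else 0 := by
    intro j
    by_cases hji : j = i
    · subst hji
      have : j.castSucc ≠ j.succ := Fin.castSucc_lt_succ.ne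
      simp [ffMatrix, this, mulVec, dotProduct]
    · by_cases hj : j.castSucc = i.succ
      · simp only [ffMatrix, hji, hj, dif_neg, dif_pos, not_false_iff, if_true, if_false, zero_add]
        -- The level is generalized so that the index equality can be eliminated and the cast
        -- disappears.
        have hgen : ∀ (k : Fin (n + 1)) (hk : k = i.succ),
            ∑ b : Fin (p k), B i a (Fin.cast (congrArg p hk) b) * w k b = (B i *ᵥ w i.succ) a := by
          rintro k rfl
          simp [mulVec, dotProduct]
        exact hgen _ hj
      · simp [ffMatrix, hji, hj]
  rw [Finset.sum_congr rfl fun j _ => hblock j, Finset.sum_add_distrib,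
    Finset.sum_ite_eq' Finset.univ i, if_pos (Finset.mem_univ i)]
  congr 1
  split_ifs with h
  · refine Finset.sum_eq_zero fun j _ => if_neg ?_
    rw [h]; exact Fin.castSucc_ne_last j
  · obtain ⟨k, hk⟩ := Fin.exists_castSucc_eq.2 h
    simp [← hk, Fin.castSucc_inj]

/-- Positivity of `n` matters: for n = 0 the left side is an empty sum, while the right side still
sees level 0. -/
lemma ffInit_dotProduct (hn : 0 < n) (π : Fin (p 0) → ℝ)
    (w : ∀ k : Fin (n + 1), Fin (p k) → ℝ) :
    (ffInit π ⬝ᵥ fun x : Σ i : Fin n, Fin (p i.castSucc) => w x.1.castSucc x.2) = π ⬝ᵥ w 0 := by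
  rw [dotProduct, Fintype.sum_sigma]
  obtain ⟨m, rfl⟩ : ∃ m, n = m + 1 := ⟨n - 1, by omega⟩
  rw [Finset.sum_eq_single (0 : Fin (m + 1))]
  · simp [ffInit, dotProduct]
    rfl
  · intro j _ hj
    have : j.castSucc ≠ 0 := by simpa using hj
    simp [ffInit, this]
  · simp

variable {C : ∀ i : Fin n, Matrix (Fin (p i.castSucc)) (Fin (p i.castSucc)) ℝ}
  {D : ∀ i : Fin n, Matrix (Fin (p i.castSucc)) (Fin (p i.succ)) ℝ} {π : Fin (p 0) → ℝ}
  {α : Fin n → ℝ}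

/-- Block vectors live on levels 1 to n; padding the extra level by 0 supplies the starting value of
a descending induction. -/
lemma exists_extend (v : (Σ i : Fin n, Fin (p i.castSucc)) → ℝ) :
    ∃ w : ∀ k : Fin (n + 1), Fin (p k) → ℝ,
      w (Fin.last n) = 0 ∧ v = fun x => w x.1.castSucc x.2 :=
  ⟨Fin.lastCases (motive := fun k => Fin (p k) → ℝ) 0 fun i a => v ⟨i, a⟩,
    by simp, by ext ⟨i, a⟩; simp⟩

/-- Block row i of a kernel vector reads (u_i^{α_i} I − C_i) w_i = D_i w_{i+1}, so vanishing passes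
from the last level down to the first. -/
lemma IsFeedForward.isUnit_ffResolvent (h : IsFeedForward C D π) {u : Fin n → ℝ}
    (hu : ∀ i, 0 ≤ u i) : IsUnit (ffResolvent α C D u) := by
  rw [← mulVec_injective_iff_isUnit]
  refine (injective_iff_map_eq_zero (ffResolvent α C D u).mulVecLin).2 fun v hv => ?_
  rw [mulVecLin_apply] at hv
  obtain ⟨w, hlast, rfl⟩ := exists_extend v
  have hrec : ∀ i : Fin n, w i.succ = 0 → w i.castSucc = 0 := by
    intro i hi
    have hz : (u i ^ α i • 1 - C i) *ᵥ w i.castSucc = 0 := by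
      ext a
      have := congrFun hv ⟨i, a⟩
      rw [ffResolvent, ffMatrix_mulVec, hi] at this
      simpa using this
    exact (mulVec_injective_iff_isUnit.2
      ((h.subIntensity i).isUnit_resolvent (Real.rpow_nonneg (hu i) (α i)))) (by simpa using hz)
  have hzero : ∀ k, w k = 0 := fun k => by
    induction k using Fin.reverseInduction with
    | last => exact hlast
    | cast i ih => exact hrec i ih
  ext x
  simp [hzero]

lemma IsFeedForward.ffResolvent_inv_mulVec (h : IsFeedForward C D π) {u : Fin n → ℝ}
    (hn : 0 < n) (hu : ∀ i, 0 ≤ u i) :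
    ffInit π ⬝ᵥ ((ffResolvent α C D u)⁻¹ *ᵥ ffExit D) = productLaplace α C D π u := by
  obtain ⟨w, hlast, hw⟩ :=
    exists_backward_recursion (fun i => (u i ^ α i • 1 - C i)⁻¹ * D i) (1 : Fin (p (Fin.last n)) → ℝ)
  -- The diagonal block contributes D_i w_{i+1}, which the off-diagonal block cancels in every row
  -- except the last; there D_n e survives.
  have hsol : ffResolvent α C D u *ᵥ (fun x => w x.1.castSucc x.2) = ffExit D := by
    ext ⟨i, a⟩
    have hunit := (isUnit_iff_isUnit_det _).1
      ((h.subIntensity i).isUnit_resolvent (Real.rpow_nonneg (hu i) (α i)))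
    rw [ffResolvent, ffMatrix_mulVec, hw i, mulVec_mulVec, mul_nonsing_inv_cancel_left _ _ hunit]
    simp only [ffExit]
    split_ifs with hi
    · rw [add_zero]
      have : ∀ k : Fin (n + 1), k = Fin.last n → w k = 1 := by rintro k rfl; exact hlast
      rw [this _ hi]
    · simp [neg_mulVec]
  have hunit := (isUnit_iff_isUnit_det _).1 (h.isUnit_ffResolvent (α := α) hu)
  rw [← hsol, mulVec_mulVec, nonsing_inv_mul _ hunit, one_mulVec, ffInit_dotProduct hn,
    productLaplace, ← hlast, chainProd_mulVec_of_recursion _ w hw]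

lemma ffResolvent_eq (u : Fin n → ℝ) :
    diagonal (ffReward p *ᵥ fun k => u k ^ α k) - ffMatrix C D = ffResolvent α C D u := by
  ext ⟨i, a⟩ ⟨j, b⟩
  have hd : (ffReward p *ᵥ fun k => u k ^ α k) ⟨i, a⟩ = u i ^ α i := by
    simp [ffReward, mulVec, dotProduct]
  by_cases hij : j = i
  · subst hij
    by_cases hab : a = b
    · subst hab; simp [ffResolvent, ffMatrix, hd]
    · simp [ffResolvent, ffMatrix, hab]
  · have hne : (⟨i, a⟩ : Σ i : Fin n, Fin (p i.castSucc)) ≠ ⟨j, b⟩ := by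
      rintro ⟨⟩; exact hij rfl
    by_cases hj : j.castSucc = i.succ
    · simp [ffResolvent, ffMatrix, hij, hj, diagonal_apply_ne _ hne]
    · simp [ffResolvent, ffMatrix, hij, hj, diagonal_apply_ne _ hne]

/-- Row sums C_i e + D_i e cancel; only the last block row, whose D_n is absent from the matrix, has
an exit rate. -/
lemma IsFeedForward.exitVec_ffMatrix (h : IsFeedForward C D π) :
    exitVec (ffMatrix C D) = ffExit D := by
  ext ⟨i, a⟩
  have h1 : (1 : (Σ i : Fin n, Fin (p i.castSucc)) → ℝ) =
    fun x => (fun k _ => 1 : ∀ k : Fin (n + 1), Fin (p k) → ℝ) x.1.castSucc x.2 := rfl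
  have h2 : -(C i *ᵥ 1) a = (D i *ᵥ 1) a := congrFun (h.exit_eq i) a
  rw [exitVec, Pi.neg_apply, h1,
    ffMatrix_mulVec C D (fun k _ => 1 : ∀ k : Fin (n + 1), Fin (p k) → ℝ)]
  change -((C i *ᵥ 1) a + if i.succ = Fin.last n then 0 else (D i *ᵥ 1) a) = _
  simp only [ffExit]
  split_ifs <;> linarith

lemma IsFeedForward.gmmlLaplace_eq (h : IsFeedForward C D π) (u : Fin n → ℝ) :
    gmmlLaplace α (ffInit π) (ffMatrix C D) (ffReward p) u =
      ffInit π ⬝ᵥ ((ffResolvent α C D u)⁻¹ *ᵥ ffExit D) := by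
  rw [gmmlLaplace, ffResolvent_eq, h.exitVec_ffMatrix]

lemma IsFeedForward.neg_inv_mul_mulVec_one (h : IsFeedForward C D π) (i : Fin n) :
    ((-C i)⁻¹ * D i) *ᵥ 1 = 1 := by
  have hunit := (isUnit_iff_isUnit_det _).1 ((h.subIntensity i).isUnit_resolvent le_rfl)
  rw [zero_smul, zero_sub] at hunit
  rw [← mulVec_mulVec, ← h.exit_eq, ← neg_mulVec, mulVec_mulVec, nonsing_inv_mul _ hunit,
    one_mulVec]

lemma IsFeedForward.isPhaseTypeRep_marginal (h : IsFeedForward C D π) (i : Fin n) :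
    IsPhaseTypeRep (marginalInit C D π i) (C i) where
  init_nonneg a := by
    rw [marginalInit, vecMul, dotProduct]
    refine Finset.sum_nonneg fun b _ => mul_nonneg (h.init_nonneg b) (chainProd_nonneg ?_ _ b a)
    intro j c d
    rw [mul_apply]
    refine Finset.sum_nonneg fun e _ => mul_nonneg ?_ (h.nonneg j e d)
    simpa using (h.subIntensity j).resolvent_nonneg le_rfl c e
  init_sum := by
    have h1 : chainProd (fun j => (-C j)⁻¹ * D j) i.castSucc *ᵥ 1 = 1 :=
      chainProd_mulVec_of_recursion _ (fun _ => 1)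
        (fun i => (h.neg_inv_mul_mulVec_one i).symm) _
    have h2 : marginalInit C D π i ⬝ᵥ 1 = π ⬝ᵥ 1 := by
      rw [marginalInit, ← dotProduct_mulVec, h1]
    simpa [dotProduct, h.init_sum] using h2
  subIntensity := h.subIntensity i

/-- Since 0^{α_j} = 0 for α_j > 0, the factors before i assemble into β_i, those after i fix e, and
the i-th leaves D_i e = −C_i e. -/
lemma IsFeedForward.productLaplace_single (h : IsFeedForward C D π) (hα : ∀ i, 0 < α i)
    (i : Fin n) (v : ℝ) :
    productLaplace α C D π (Pi.single i v) =
      marginalInit C D π i ⬝ᵥ ((v ^ α i • 1 - C i)⁻¹ *ᵥ exitVec (C i)) := by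
  set A : ∀ j : Fin n, Matrix (Fin (p j.castSucc)) (Fin (p j.succ)) ℝ :=
    fun j => ((Pi.single i v : Fin n → ℝ) j ^ α j • 1 - C j)⁻¹ * D j with hA
  have hne : ∀ j, j ≠ i → A j = (-C j)⁻¹ * D j := fun j hj => by
    simp [hA, hj, Real.zero_rpow (hα j).ne']
  have htail : ∀ k, i.succ ≤ k → chainProd A k *ᵥ 1 = chainProd A i.succ *ᵥ 1 := by
    intro k
    induction k using Fin.induction with
    | zero => intro hk; simp at hk
    | succ j ih =>
      intro hk
      rcases eq_or_ne j i with rfl | hj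
      · rfl
      · rw [chainProd_succ A j, ← mulVec_mulVec, hne j hj, h.neg_inv_mul_mulVec_one, ih]
        rw [Fin.succ_le_castSucc_iff]
        exact lt_of_le_of_ne (Fin.succ_le_succ_iff.1 hk) hj.symm
  have hhead : chainProd A i.castSucc = chainProd (fun j => (-C j)⁻¹ * D j) i.castSucc :=
    chainProd_congr _ fun j hj => hne j (Fin.castSucc_lt_castSucc_iff.1 hj).ne
  rw [productLaplace, htail _ (Fin.le_last _), chainProd_succ, hhead, marginalInit,
    ← dotProduct_mulVec, exitVec, h.exit_eq, mulVec_mulVec, mulVec_mulVec, Matrix.mul_assoc]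
  simp [hA]

end FeedForward
open MeasureTheory Set

/-! ### Matrix products as sums over paths -/

section Paths

/-- Expansion of an ordered matrix product as a sum over paths of indices. -/
lemma dotProduct_chainProd_mulVec {n : ℕ} {p : Fin (n + 1) → ℕ}
    (A : ∀ i : Fin n, Matrix (Fin (p i.castSucc)) (Fin (p i.succ)) ℝ) (π : Fin (p 0) → ℝ)
    (v : Fin (p (Fin.last n)) → ℝ) :
    π ⬝ᵥ (chainProd A (Fin.last n) *ᵥ v) =
      ∑ c : ∀ k, Fin (p k), π (c 0) * (∏ i, A i (c i.castSucc) (c i.succ)) * v (c (Fin.last n)) := by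
  induction n with
  | zero =>
    rw [← (Equiv.piUnique fun k : Fin 1 => Fin (p k)).symm.sum_comp]
    change π ⬝ᵥ ((1 : Matrix (Fin (p 0)) (Fin (p 0)) ℝ) *ᵥ v) = _
    rw [one_mulVec]
    simp only [Finset.univ_eq_empty, Finset.prod_empty, mul_one]
    rfl
  | succ m ih =>
    -- The last factor is absorbed into the terminal vector, leaving a product of m factors for the
    -- induction hypothesis; `Fin.snocEquiv` then appends the last index to each path.
    have hstep : chainProd A (Fin.last (m + 1)) *ᵥ v =
        chainProd (p := fun k => p k.castSucc) (fun i => A i.castSucc) (Fin.last m) *ᵥ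
          (A (Fin.last m) *ᵥ v) := by
      have hinit : ∀ k : Fin (m + 1), chainProd A k.castSucc =
          chainProd (p := fun k => p k.castSucc) (fun i => A i.castSucc) k := by
        intro k
        induction k using Fin.induction with
        | zero => rfl
        | succ i ih =>
          rw [chainProd_succ]
          change chainProd A i.castSucc.castSucc * A i.castSucc = _
          rw [ih]
          rfl
      rw [mulVec_mulVec, ← hinit]
      rfl
    rw [hstep]
    refine (ih (p := fun k => p k.castSucc) (fun i => A i.castSucc) π (A (Fin.last m) *ᵥ v)).trans ?_
    rw [← (Fin.snocEquiv fun k => Fin (p k)).sum_comp, Fintype.sum_prod_type, Finset.sum_comm]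
    refine Finset.sum_congr rfl fun c _ => ?_
    rw [mulVec, dotProduct, Finset.mul_sum]
    refine Finset.sum_congr rfl fun b _ => ?_
    have h0 : (Fin.snocEquiv fun k => Fin (p k)) (b, c) 0 = c 0 :=
      Fin.snoc_castSucc (α := fun k => Fin (p k)) b c 0
    have hl : (Fin.snocEquiv fun k => Fin (p k)) (b, c) (Fin.last (m + 1)) = b :=
      Fin.snoc_last (α := fun k => Fin (p k)) b c
    have hc : ∀ k, (Fin.snocEquiv fun k => Fin (p k)) (b, c) k.castSucc = c k := fun k =>
      Fin.snoc_castSucc (α := fun k => Fin (p k)) b c k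
    rw [Fin.prod_univ_castSucc, h0, hl, hc]
    have hp : ∀ i : Fin m, A i.castSucc ((Fin.snocEquiv fun k => Fin (p k)) (b, c) i.castSucc.castSucc)
        ((Fin.snocEquiv fun k => Fin (p k)) (b, c) i.castSucc.succ) =
        A i.castSucc (c i.castSucc) (c i.succ) := by
      intro i
      rw [hc]
      exact congrArg _ (hc i.succ)
    have hlast : (Fin.snocEquiv fun k => Fin (p k)) (b, c) (Fin.last m).succ = b := hl
    rw [Finset.prod_congr rfl fun i _ => hp i, hlast]
    ring

end Paths

/-! ### Neumann series -/

section Resolvent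
variable {ι : Type*} [Fintype ι] [DecidableEq ι]

lemma exists_pow_apply_le (A : Matrix ι ι ℝ) :
    ∃ r : ℝ, 0 < r ∧ ∀ k a b, |(A ^ k) a b| ≤ r ^ k := by
  have hpos : 0 ≤ ∑ b, ∑ c, |A c b| :=
    Finset.sum_nonneg fun _ _ => Finset.sum_nonneg fun _ _ => abs_nonneg _
  -- This constant dominates every absolute column sum, which drives the induction; the summand 1
  -- keeps it positive.
  refine ⟨1 + ∑ b, ∑ c, |A c b|, by linarith, fun k => ?_⟩
  set r := 1 + ∑ b, ∑ c, |A c b| with hr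
  induction k with
  | zero => intro a b; rw [pow_zero, pow_zero, one_apply]; split_ifs <;> simp
  | succ k ih =>
    intro a b
    have hcol : ∑ c, |A c b| ≤ r := by
      have := Finset.single_le_sum (f := fun b => ∑ c, |A c b|)
        (fun _ _ => Finset.sum_nonneg fun _ _ => abs_nonneg _) (Finset.mem_univ b)
      linarith
    calc |(A ^ (k + 1)) a b| ≤ ∑ c, |(A ^ k) a c * A c b| := by
          rw [pow_succ, mul_apply]; exact Finset.abs_sum_le_sum_abs _ _
      _ ≤ ∑ c, r ^ k * |A c b| := Finset.sum_le_sum fun c _ => by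
          rw [abs_mul]; exact mul_le_mul_of_nonneg_right (ih a c) (abs_nonneg _)
      _ = r ^ k * ∑ c, |A c b| := (Finset.mul_sum ..).symm
      _ ≤ r ^ (k + 1) := by
          rw [pow_succ]; exact mul_le_mul_of_nonneg_left hcol (by positivity)

/-- The Neumann series of the resolvent, entrywise. -/
lemma hasSum_resolvent {A : Matrix ι ι ℝ} {r s : ℝ} (hr : 0 < r)
    (hA : ∀ k a b, |(A ^ k) a b| ≤ r ^ k) (hs : r < s) (a b : ι) :
    HasSum (fun k : ℕ => (s ^ (k + 1))⁻¹ * (A ^ k) a b)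
      ((s • (1 : Matrix ι ι ℝ) - A)⁻¹ a b) := by
  have hs0 : 0 < s := hr.trans hs
  have hsum : Summable fun k : ℕ => (s ^ k)⁻¹ • A ^ k := by
    refine Pi.summable.2 fun a => Pi.summable.2 fun b => ?_
    refine Summable.of_norm_bounded (g := fun k => (r / s) ^ k)
      (summable_geometric_of_lt_one (by positivity) ((div_lt_one hs0).2 hs)) fun k => ?_
    rw [Matrix.smul_apply, smul_eq_mul, norm_mul, Real.norm_eq_abs, Real.norm_eq_abs,
      abs_of_pos (by positivity), div_pow, div_eq_inv_mul]
    exact mul_le_mul_of_nonneg_left (hA k a b) (by positivity)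
  obtain ⟨S, hS⟩ := hsum
  have hterm : ∀ k : ℕ, s⁻¹ • (s ^ k)⁻¹ • A ^ k = (s ^ (k + 1))⁻¹ • A ^ k := fun k => by
    rw [smul_smul, pow_succ, mul_inv, mul_comm]
  have h1 : HasSum (fun k : ℕ => (s ^ (k + 1))⁻¹ • A ^ k) (s⁻¹ • S) := by
    have := hS.const_smul s⁻¹
    simpa only [hterm] using this
  -- With S = ∑ (A/s)^k, multiplication by A/s drops the zeroth term of the series.
  have h2 : A * (s⁻¹ • S) = S - 1 := by
    have h3 := h1.mul_left A
    have h4 := (hasSum_nat_add_iff' 1).2 hS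
    simp only [Finset.sum_range_one, pow_zero, inv_one, one_smul] at h4
    simp only [Matrix.mul_smul, ← pow_succ'] at h3
    rw [Matrix.mul_smul]
    exact h3.unique h4
  have h5 : (s • (1 : Matrix ι ι ℝ) - A) * (s⁻¹ • S) = 1 := by
    rw [Matrix.sub_mul, h2, Matrix.smul_mul, Matrix.one_mul, smul_smul, mul_inv_cancel₀ hs0.ne',
      one_smul, sub_sub_cancel]
  rw [inv_eq_right_inv h5]
  exact Pi.hasSum.1 (Pi.hasSum.1 h1 a) b

end Resolvent

/-! ### Scalar Mittag-Leffler type series and their Laplace transforms -/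

section GammaSeries

/-- Restrict R^{−s} Γ(s) = ∫ t^{s−1} e^{−Rt} dt to (1, 2], where t^{s−1} = t^s / t ≥ 1/2 and e^{−Rt}
≥ e^{−2R}. As R is arbitrary, Γ outgrows every geometric sequence. -/
lemma rpow_mul_le_Gamma {R s : ℝ} (hR : 0 < R) (hs : 0 < s) :
    R ^ s * (Real.exp (-(2 * R)) / 2) ≤ Real.Gamma s := by
  have key := Real.integral_rpow_mul_exp_neg_mul_Ioi hs hR
  have hG := Real.Gamma_pos_of_pos hs
  -- The integral of a nonintegrable function is 0 by convention, so a nonzero value proves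
  -- integrability.
  have hint : IntegrableOn (fun t : ℝ => t ^ (s - 1) * Real.exp (-(R * t))) (Ioi 0) :=
    .of_integral_ne_zero (by rw [key]; positivity)
  have h1 : ∫ t in Ioc (1 : ℝ) 2, t ^ (s - 1) * Real.exp (-(R * t)) ≤
      ∫ t in Ioi (0 : ℝ), t ^ (s - 1) * Real.exp (-(R * t)) := by
    refine setIntegral_mono_set hint ?_ (LE.le.eventuallyLE ?_)
    · refine (ae_restrict_iff' measurableSet_Ioi).2 (.of_forall fun t (ht : 0 < t) => ?_)
      simp only [Pi.zero_apply]
      positivity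
    · exact fun t ht => zero_lt_one.trans ht.1
  have h2 : Real.exp (-(2 * R)) / 2 ≤ ∫ t in Ioc (1 : ℝ) 2, t ^ (s - 1) * Real.exp (-(R * t)) := by
    have hc : ∫ _ in Ioc (1 : ℝ) 2, Real.exp (-(2 * R)) / 2 = Real.exp (-(2 * R)) / 2 := by
      simp; norm_num
    rw [← hc]
    refine setIntegral_mono_on (integrableOn_const (by simp))
      (hint.mono_set fun t ht => zero_lt_one.trans ht.1) measurableSet_Ioc fun t ht => ?_
    have ht0 : 0 < t := zero_lt_one.trans ht.1
    have h3 : (1 : ℝ) / 2 ≤ t ^ (s - 1) := by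
      rw [Real.rpow_sub_one ht0.ne']
      have : 1 ≤ t ^ s := Real.one_le_rpow ht.1.le hs.le
      rw [div_le_div_iff₀ two_pos ht0]
      linarith [ht.2]
    have h4 : Real.exp (-(2 * R)) ≤ Real.exp (-(R * t)) :=
      Real.exp_le_exp.2 (by nlinarith [ht.2])
    calc Real.exp (-(2 * R)) / 2 = 1 / 2 * Real.exp (-(2 * R)) := by ring
      _ ≤ t ^ (s - 1) * Real.exp (-(R * t)) := mul_le_mul h3 h4 (Real.exp_pos _).le (by positivity)
  have h5 := (h2.trans h1).trans_eq key
  calc R ^ s * (Real.exp (-(2 * R)) / 2) ≤ R ^ s * ((1 / R) ^ s * Real.Gamma s) :=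
        mul_le_mul_of_nonneg_left h5 (by positivity)
    _ = Real.Gamma s := by
        rw [← mul_assoc, ← Real.mul_rpow hR.le (by positivity), mul_one_div_cancel hR.ne',
          Real.one_rpow, one_mul]

lemma summable_inv_Gamma_mul_pow {α : ℝ} (hα : 0 < α) {y : ℝ} (hy : 0 ≤ y) :
    Summable fun k : ℕ => (Real.Gamma (α * k + α))⁻¹ * y ^ k := by
  -- Chosen so that R^α = y + 1, which gives a geometric majorant of ratio y/(y+1) < 1.
  set R := (y + 1) ^ α⁻¹ with hRdef
  have hR : 0 < R := by positivity
  have hRα : R ^ α = y + 1 := by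
    rw [hRdef, ← Real.rpow_mul (by positivity), inv_mul_cancel₀ hα.ne', Real.rpow_one]
  have hb : ∀ k : ℕ, (Real.Gamma (α * k + α))⁻¹ * y ^ k ≤
      (Real.exp (-(2 * R)) / 2)⁻¹ * (y + 1)⁻¹ * (y / (y + 1)) ^ k := by
    intro k
    have hpow : R ^ (α * k + α) = (y + 1) ^ k * (y + 1) := by
      rw [Real.rpow_add hR, Real.rpow_mul hR.le, hRα, Real.rpow_natCast]
    have h := rpow_mul_le_Gamma hR (s := α * k + α) (by positivity)
    rw [hpow] at h
    calc (Real.Gamma (α * k + α))⁻¹ * y ^ k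
        ≤ ((y + 1) ^ k * (y + 1) * (Real.exp (-(2 * R)) / 2))⁻¹ * y ^ k :=
          mul_le_mul_of_nonneg_right (inv_anti₀ (by positivity) h) (by positivity)
      _ = _ := by rw [div_pow]; field_simp
  refine Summable.of_nonneg_of_le (fun k => ?_) hb ((summable_geometric_of_lt_one (by positivity)
    ((div_lt_one (by positivity)).2 (by linarith))).mul_left _)
  have := Real.Gamma_pos_of_pos (s := α * k + α) (by positivity)
  positivity

/-- The scalar series `∑ k, c k * y ^ k / Γ(α k + α)`. -/
noncomputable def gammaSeries (α : ℝ) (c : ℕ → ℝ) (y : ℝ) : ℝ :=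
  ∑' k : ℕ, (Real.Gamma (α * k + α))⁻¹ * (y ^ k * c k)

lemma norm_gammaSeries_term_le {α : ℝ} (hα : 0 < α) {c : ℕ → ℝ} {r : ℝ}
    (hc : ∀ k, |c k| ≤ r ^ k) {y Y : ℝ} (hy : |y| ≤ Y) (k : ℕ) :
    ‖(Real.Gamma (α * k + α))⁻¹ * (y ^ k * c k)‖ ≤
      (Real.Gamma (α * k + α))⁻¹ * (Y * r) ^ k := by
  have := Real.Gamma_pos_of_pos (s := α * k + α) (by positivity)
  rw [Real.norm_eq_abs, abs_mul, abs_of_pos (inv_pos.2 this), abs_mul, abs_pow, mul_pow]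
  have hY : 0 ≤ Y := (abs_nonneg y).trans hy
  gcongr
  exact hc k

lemma summable_gammaSeries {α : ℝ} (hα : 0 < α) {c : ℕ → ℝ} {r : ℝ} (hr : 0 < r)
    (hc : ∀ k, |c k| ≤ r ^ k) (y : ℝ) :
    Summable fun k : ℕ => (Real.Gamma (α * k + α))⁻¹ * (y ^ k * c k) :=
  .of_norm_bounded (summable_inv_Gamma_mul_pow hα (by positivity))
    (norm_gammaSeries_term_le hα hc le_rfl)

lemma continuous_gammaSeries {α : ℝ} (hα : 0 < α) {c : ℕ → ℝ} {r : ℝ} (hr : 0 < r)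
    (hc : ∀ k, |c k| ≤ r ^ k) : Continuous (gammaSeries α c) := by
  refine continuous_iff_continuousAt.2 fun y => ?_
  have h : ContinuousOn (gammaSeries α c) (Ioo (-(|y| + 1)) (|y| + 1)) :=
    continuousOn_tsum (fun k => by fun_prop)
      (summable_inv_Gamma_mul_pow hα (y := (|y| + 1) * r) (by positivity))
      fun k z hz => norm_gammaSeries_term_le hα hc (abs_le.2 ⟨hz.1.le, hz.2.le⟩) k
  exact h.continuousAt (Ioo_mem_nhds (by linarith [neg_abs_le y]) (by linarith [le_abs_self y]))

lemma integrableOn_rpow_mul_exp {s u : ℝ} (hs : 0 < s) (hu : 0 < u) :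
    IntegrableOn (fun t : ℝ => t ^ (s - 1) * Real.exp (-(u * t))) (Ioi 0) :=
  .of_integral_ne_zero (by
    rw [Real.integral_rpow_mul_exp_neg_mul_Ioi hs hu]
    have := Real.Gamma_pos_of_pos hs
    positivity)

/-- The scalar `c` is free so that `|c|` yields the integral of the norm of a term. -/
lemma gammaSeries_laplace_term {α u : ℝ} (hα : 0 < α) (hu : 0 < u) (c : ℝ) (k : ℕ) :
    IntegrableOn (fun t : ℝ => Real.exp (-(u * t)) *
      (t ^ (α - 1) * ((Real.Gamma (α * k + α))⁻¹ * ((t ^ α) ^ k * c)))) (Ioi 0) ∧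
    ∫ t in Ioi (0 : ℝ), Real.exp (-(u * t)) *
      (t ^ (α - 1) * ((Real.Gamma (α * k + α))⁻¹ * ((t ^ α) ^ k * c))) =
      ((u ^ α) ^ (k + 1))⁻¹ * c := by
  have hs : 0 < α * k + α := by positivity
  have hG := Real.Gamma_pos_of_pos hs
  have heq : EqOn (fun t : ℝ => Real.exp (-(u * t)) *
      (t ^ (α - 1) * ((Real.Gamma (α * k + α))⁻¹ * ((t ^ α) ^ k * c))))
      (fun t => ((Real.Gamma (α * k + α))⁻¹ * c) *
        (t ^ (α * k + α - 1) * Real.exp (-(u * t)))) (Ioi 0) := by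
    intro t (ht : 0 < t)
    have : t ^ (α * k + α - 1) = (t ^ α) ^ k * t ^ (α - 1) := by
      rw [add_sub_assoc, Real.rpow_add ht, Real.rpow_mul ht.le, Real.rpow_natCast]
    simp only [this]
    ring
  constructor
  · exact IntegrableOn.congr_fun (Integrable.const_mul (integrableOn_rpow_mul_exp hs hu) _)
      heq.symm measurableSet_Ioi
  · rw [setIntegral_congr_fun measurableSet_Ioi heq, integral_const_mul,
      Real.integral_rpow_mul_exp_neg_mul_Ioi hs hu]
    have : (1 / u) ^ (α * k + α) = ((u ^ α) ^ (k + 1))⁻¹ := by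
      rw [one_div, Real.inv_rpow hu.le, ← mul_add_one, Real.rpow_mul hu.le]
      norm_cast
    rw [this]
    field_simp

/-- Termwise Laplace transform of `t ^ (α - 1) * ∑ k, c k * t ^ (α k) / Γ(α k + α)`. -/
lemma gammaSeries_laplace_hasSum {α u r : ℝ} (hα : 0 < α) (hu : 0 < u) (hr : 0 < r)
    (hru : r < u ^ α) {c : ℕ → ℝ} (hc : ∀ k, |c k| ≤ r ^ k) :
    HasSum (fun k : ℕ => ((u ^ α) ^ (k + 1))⁻¹ * c k)
      (∫ t in Ioi (0 : ℝ), Real.exp (-(u * t)) * (t ^ (α - 1) * gammaSeries α c (t ^ α))) := by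
  have hnorm : ∀ k : ℕ, ∫ t in Ioi (0 : ℝ), ‖Real.exp (-(u * t)) *
      (t ^ (α - 1) * ((Real.Gamma (α * k + α))⁻¹ * ((t ^ α) ^ k * c k)))‖ =
      ((u ^ α) ^ (k + 1))⁻¹ * |c k| := by
    intro k
    rw [← (gammaSeries_laplace_term hα hu |c k| k).2]
    refine setIntegral_congr_fun measurableSet_Ioi fun t (ht : 0 < t) => ?_
    have hG := Real.Gamma_pos_of_pos (s := α * k + α) (by positivity)
    simp only [Real.norm_eq_abs, abs_mul, abs_of_pos (Real.exp_pos _),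
      abs_of_pos (Real.rpow_pos_of_pos ht _), abs_of_pos (inv_pos.2 hG), abs_pow]
  have h := hasSum_integral_of_summable_integral_norm (μ := volume.restrict (Ioi 0))
    (F := fun (k : ℕ) (t : ℝ) => Real.exp (-(u * t)) *
      (t ^ (α - 1) * ((Real.Gamma (α * k + α))⁻¹ * ((t ^ α) ^ k * c k))))
    (fun k => (gammaSeries_laplace_term hα hu (c k) k).1) (by
      simp only [hnorm]
      refine Summable.of_nonneg_of_le (fun k => by positivity) (fun k => ?_)
        ((summable_geometric_of_lt_one (r := r / u ^ α) (by positivity)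
          ((div_lt_one (by positivity)).2 hru)).mul_left (u ^ α)⁻¹)
      calc ((u ^ α) ^ (k + 1))⁻¹ * |c k| ≤ ((u ^ α) ^ (k + 1))⁻¹ * r ^ k :=
            mul_le_mul_of_nonneg_left (hc k) (by positivity)
        _ = _ := by rw [div_pow, pow_succ]; field_simp)
  simp only [tsum_mul_left, (gammaSeries_laplace_term hα hu _ _).2] at h
  exact h

/-- The same series with coefficients r^k is a majorant; its integral is a sum of positive terms,
hence nonzero, hence it is integrable. -/
lemma integrableOn_gammaSeries_laplace {α u r : ℝ} (hα : 0 < α) (hu : 0 < u) (hr : 0 < r)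
    (hru : r < u ^ α) {c : ℕ → ℝ} (hc : ∀ k, |c k| ≤ r ^ k) :
    IntegrableOn (fun t => Real.exp (-(u * t)) * (t ^ (α - 1) * gammaSeries α c (t ^ α)))
      (Ioi 0) := by
  have hmaj : IntegrableOn (fun t => Real.exp (-(u * t)) *
      (t ^ (α - 1) * gammaSeries α (fun k => r ^ k) (t ^ α))) (Ioi 0) := by
    refine .of_integral_ne_zero (ne_of_gt ?_)
    have h := gammaSeries_laplace_hasSum hα hu hr hru (c := fun k => r ^ k)
      fun k => by rw [abs_of_pos (by positivity)]
    rw [← h.tsum_eq]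
    exact h.summable.tsum_pos (fun k => by positivity) 0 (by positivity)
  refine hmaj.mono' ?_ ?_
  · refine ContinuousOn.aestronglyMeasurable (ContinuousOn.mul (by fun_prop)
      (ContinuousOn.mul ?_ ?_)) measurableSet_Ioi
    · exact fun t ht => (Real.continuousAt_rpow_const t _ (.inl (ne_of_gt ht))).continuousWithinAt
    · exact (continuous_gammaSeries hα hr hc).comp_continuousOn
        fun t ht => (Real.continuousAt_rpow_const t _ (.inl (ne_of_gt ht))).continuousWithinAt
  · refine (ae_restrict_iff' measurableSet_Ioi).2 (.of_forall fun t (ht : 0 < t) => ?_)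
    rw [norm_mul, norm_mul, Real.norm_of_nonneg (Real.exp_pos _).le,
      Real.norm_of_nonneg (Real.rpow_nonneg ht.le _)]
    gcongr
    refine tsum_of_norm_bounded (summable_gammaSeries hα hr (c := fun k => r ^ k)
      (fun k => by rw [abs_of_pos (by positivity)]) (t ^ α)).hasSum fun k => ?_
    have := norm_gammaSeries_term_le hα hc (y := t ^ α) (le_of_eq (abs_of_pos (by positivity))) k
    rwa [mul_pow] at this

end GammaSeries

/-! ### Laplace transform of the matrix Mittag-Leffler kernel -/

section MittagLeffler
variable {ι κ : Type*} [Fintype ι] [DecidableEq ι] {α : ℝ}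

lemma mittagLeffler_apply (hα : 0 < α) (C : Matrix ι ι ℝ) (y : ℝ) (a b : ι) :
    mittagLeffler α α (y • C) a b = gammaSeries α (fun k => (C ^ k) a b) y := by
  obtain ⟨r, hr, hC⟩ := exists_pow_apply_le C
  have hsum : ∀ a b, Summable fun k : ℕ =>
      ((Real.Gamma (α * k + α))⁻¹ • (y • C) ^ k) a b := fun a b => by
    simpa only [Matrix.smul_apply, smul_pow, smul_eq_mul] using
      summable_gammaSeries hα hr (fun k => hC k a b) y
  have hS : Summable fun k : ℕ => (Real.Gamma (α * k + α))⁻¹ • (y • C) ^ k :=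
    Pi.summable.2 fun a => Pi.summable.2 fun b => hsum a b
  have h := (Pi.hasSum.1 (Pi.hasSum.1 hS.hasSum a) b).tsum_eq
  rw [mittagLeffler, ← h, gammaSeries]
  simp only [Matrix.smul_apply, smul_pow, smul_eq_mul]

lemma continuousOn_mlKernel (hα : 0 < α) (C : Matrix ι ι ℝ) (D : Matrix ι κ ℝ) (a : ι) (b : κ) :
    ContinuousOn (fun t : ℝ => (t ^ (α - 1) • (mittagLeffler α α (t ^ α • C) * D)) a b)
      (Ioi 0) := by
  obtain ⟨r, hr, hC⟩ := exists_pow_apply_le C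
  simp only [Matrix.smul_apply, smul_eq_mul, mul_apply, mittagLeffler_apply hα]
  have hrpow : ∀ q : ℝ, ContinuousOn (fun t : ℝ => t ^ q) (Ioi 0) := fun q t ht =>
    (Real.continuousAt_rpow_const t _ (.inl (ne_of_gt ht))).continuousWithinAt
  exact (hrpow _).mul (continuousOn_finsetSum _ fun c _ =>
    ((continuous_gammaSeries hα hr fun k => hC k a c).comp_continuousOn (hrpow α)).mul_const _)

/-- The Laplace transform of `t ^ (α - 1) E_{α,α}(C t ^ α) D`. -/
lemma mlKernel_laplace (hα : 0 < α) {C : Matrix ι ι ℝ} {r : ℝ} (hr : 0 < r)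
    (hC : ∀ k a b, |(C ^ k) a b| ≤ r ^ k) {u : ℝ} (hu : 0 < u) (hru : r < u ^ α)
    (D : Matrix ι κ ℝ) (a : ι) (b : κ) :
    IntegrableOn (fun t : ℝ => Real.exp (-(u * t)) *
      (t ^ (α - 1) • (mittagLeffler α α (t ^ α • C) * D)) a b) (Ioi 0) ∧
    ∫ t in Ioi (0 : ℝ), Real.exp (-(u * t)) *
      (t ^ (α - 1) • (mittagLeffler α α (t ^ α • C) * D)) a b =
      ((u ^ α • (1 : Matrix ι ι ℝ) - C)⁻¹ * D) a b := by
  have heq : ∀ t : ℝ, Real.exp (-(u * t)) *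
      (t ^ (α - 1) • (mittagLeffler α α (t ^ α • C) * D)) a b =
      ∑ c, Real.exp (-(u * t)) *
        (t ^ (α - 1) * gammaSeries α (fun k => (C ^ k) a c) (t ^ α)) * D c b := by
    intro t
    simp only [Matrix.smul_apply, smul_eq_mul, mul_apply, mittagLeffler_apply hα, Finset.mul_sum]
    exact Finset.sum_congr rfl fun c _ => by ring
  have hint : ∀ c, IntegrableOn (fun t => Real.exp (-(u * t)) *
      (t ^ (α - 1) * gammaSeries α (fun k => (C ^ k) a c) (t ^ α)) * D c b) (Ioi 0) := fun c =>
    (integrableOn_gammaSeries_laplace hα hu hr hru fun k => hC k a c).mul_const _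
  simp only [heq]
  refine ⟨integrable_finsetSum _ fun c _ => hint c, ?_⟩
  rw [integral_finsetSum _ fun c _ => hint c, mul_apply]
  refine Finset.sum_congr rfl fun c _ => ?_
  rw [integral_mul_const, (gammaSeries_laplace_hasSum hα hu hr hru fun k => hC k a c).unique
    (hasSum_resolvent hr hC hru a c)]

end MittagLeffler
open scoped NNReal BoundedContinuousFunction

/-! ### Uniqueness of Laplace transforms on the orthant -/

section LaplaceUniqueness
variable {n : ℕ}

/-- The exponential `x ↦ exp (-⟨u, x⟩)` as a bounded continuous function on the orthant. -/
noncomputable def laplaceKernel (u : Fin n → ℝ≥0) : (Fin n → ℝ≥0) →ᵇ ℝ :=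
  BoundedContinuousFunction.ofNormedAddCommGroup
    (fun x => Real.exp (-∑ k, (u k : ℝ) * (x k : ℝ))) (by fun_prop) 1 fun x => by
      rw [Real.norm_of_nonneg (Real.exp_pos _).le, Real.exp_le_one_iff, neg_nonpos]
      exact Finset.sum_nonneg fun k _ => by positivity

lemma laplaceKernel_apply (u x : Fin n → ℝ≥0) :
    laplaceKernel u x = Real.exp (-∑ k, (u k : ℝ) * (x k : ℝ)) := rfl

/-- The exponentials form a monoid. -/
noncomputable def laplaceKernelHom : Multiplicative (Fin n → ℝ≥0) →* ((Fin n → ℝ≥0) →ᵇ ℝ) where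
  toFun u := laplaceKernel u.toAdd
  map_one' := by ext x; simp [laplaceKernel_apply]
  map_mul' u v := by
    ext x
    simp only [BoundedContinuousFunction.mul_apply, laplaceKernel_apply, ← Real.exp_add, toAdd_mul,
      Pi.add_apply, NNReal.coe_add, add_mul, Finset.sum_add_distrib, neg_add]

/-- The star algebra spanned by the exponentials. -/
noncomputable def laplaceAlgebra (n : ℕ) : StarSubalgebra ℝ ((Fin n → ℝ≥0) →ᵇ ℝ) :=
  { Algebra.adjoin ℝ (MonoidHom.mrange (laplaceKernelHom (n := n)) : Set ((Fin n → ℝ≥0) →ᵇ ℝ)) with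
    star_mem' := fun {a} h => by
      have : star a = a := by ext x; simp
      rwa [this] }

lemma laplaceKernel_mem (u : Fin n → ℝ≥0) : laplaceKernel u ∈ laplaceAlgebra n :=
  Algebra.subset_adjoin ⟨Multiplicative.ofAdd u, rfl⟩

lemma laplaceAlgebra_separatesPoints :
    ((laplaceAlgebra n).map
      (BoundedContinuousFunction.toContinuousMapStarₐ ℝ)).SeparatesPoints := by
  intro x y hxy
  obtain ⟨k, hk⟩ := Function.ne_iff.1 hxy
  refine ⟨laplaceKernel (Pi.single k 1), ⟨_, ⟨_, laplaceKernel_mem (Pi.single k 1), rfl⟩, rfl⟩, ?_⟩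
  have h : ∀ z : Fin n → ℝ≥0, laplaceKernel (Pi.single k 1) z = Real.exp (-(z k : ℝ)) := by
    intro z
    rw [laplaceKernel_apply, Finset.sum_eq_single k] <;> simp +contextual
  rw [h, h]
  simpa using hk

lemma ext_of_laplace_nnreal {μ ν : Measure (Fin n → ℝ≥0)} [IsFiniteMeasure μ] [IsFiniteMeasure ν]
    (h : ∀ u, ∫ x, laplaceKernel u x ∂μ = ∫ x, laplaceKernel u x ∂ν) : μ = ν := by
  refine ext_of_forall_mem_subalgebra_integral_eq_of_polish laplaceAlgebra_separatesPoints
    fun g hg => ?_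
  -- The exponentials are closed under products, so the algebra they generate is their linear span
  -- and linearity of the integral suffices.
  have hg' : g ∈ Submodule.span ℝ
      (MonoidHom.mrange (laplaceKernelHom (n := n)) : Set ((Fin n → ℝ≥0) →ᵇ ℝ)) := by
    have : g ∈ Subalgebra.toSubmodule (Algebra.adjoin ℝ
      (MonoidHom.mrange (laplaceKernelHom (n := n)) : Set ((Fin n → ℝ≥0) →ᵇ ℝ))) := hg
    rwa [Algebra.adjoin_eq_span, Submonoid.closure_eq] at this
  clear hg
  induction hg' using Submodule.span_induction with
  | mem g hg =>
    obtain ⟨u, rfl⟩ := hg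
    exact h u.toAdd
  | zero => simp
  | add f g _ _ hf hg =>
    simp only [BoundedContinuousFunction.add_apply]
    rw [integral_add (f.integrable μ) (g.integrable μ), integral_add (f.integrable ν)
      (g.integrable ν), hf, hg]
  | smul c f _ hf =>
    simp only [BoundedContinuousFunction.smul_apply, integral_smul, hf]

/-- Finite measures on the nonnegative orthant are determined by their Laplace transforms. -/
lemma ext_of_laplace {μ ν : Measure (Fin n → ℝ)} [IsFiniteMeasure μ] [IsFiniteMeasure ν]
    (hμ : ∀ᵐ x ∂μ, ∀ k, 0 ≤ x k) (hν : ∀ᵐ x ∂ν, ∀ k, 0 ≤ x k)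
    (h : ∀ u : Fin n → ℝ, (∀ k, 0 ≤ u k) →
      ∫ x, Real.exp (-∑ k, u k * x k) ∂μ = ∫ x, Real.exp (-∑ k, u k * x k) ∂ν) : μ = ν := by
  -- The exponentials are bounded only on the orthant, so both measures are moved to ℝ≥0^n; nothing
  -- is lost, as they are carried by the orthant.
  have hφ : Measurable fun (x : Fin n → ℝ) k => (x k).toNNReal := by fun_prop
  have hj : Measurable fun (x : Fin n → ℝ≥0) k => (x k : ℝ) := by fun_prop
  have hback : ∀ ρ : Measure (Fin n → ℝ), (∀ᵐ x ∂ρ, ∀ k, 0 ≤ x k) →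
      ((ρ.map fun x k => (x k).toNNReal).map fun x k => (x k : ℝ)) = ρ := by
    intro ρ hρ
    rw [Measure.map_map hj hφ]
    refine (Measure.map_congr ?_).trans Measure.map_id
    filter_upwards [hρ] with x hx
    ext k
    simp [hx k]
  have hint : ∀ ρ : Measure (Fin n → ℝ), (∀ᵐ x ∂ρ, ∀ k, 0 ≤ x k) → ∀ u : Fin n → ℝ≥0,
      ∫ x, laplaceKernel u x ∂(ρ.map fun x k => (x k).toNNReal) =
        ∫ x, Real.exp (-∑ k, (u k : ℝ) * x k) ∂ρ := by
    intro ρ hρ u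
    rw [integral_map hφ.aemeasurable (laplaceKernel u).continuous.aestronglyMeasurable]
    refine integral_congr_ae ?_
    filter_upwards [hρ] with x hx
    simp [laplaceKernel_apply, hx]
  rw [← hback μ hμ, ← hback ν hν]
  congr 1
  refine ext_of_laplace_nnreal fun u => ?_
  rw [hint μ hμ, hint ν hν]
  exact h (fun k => u k) fun k => (u k).2

end LaplaceUniqueness
-- From a Laplace transform at large arguments to a density
section Density
variable {n : ℕ}

lemma isOpen_posOrthant : IsOpen {x : Fin n → ℝ | ∀ k, 0 < x k} := by
  simp only [ofPred_forall]
  exact isOpen_iInter_of_finite fun k => isOpen_lt continuous_const (continuous_apply k)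

lemma volume_restrict_posOrthant :
    (volume : Measure (Fin n → ℝ)).restrict {x | ∀ k, 0 < x k} =
      Measure.pi fun _ => volume.restrict (Ioi (0 : ℝ)) := by
  rw [volume_pi, ← Measure.restrict_pi_pi]
  congr 1
  ext x
  simp [mem_pi]

lemma exp_neg_sum_mul_le_one {u x : Fin n → ℝ} (hu : ∀ k, 0 ≤ u k) (hx : ∀ k, 0 ≤ x k) :
    ‖Real.exp (-∑ k, u k * x k)‖ ≤ 1 := by
  rw [Real.norm_of_nonneg (Real.exp_pos _).le, Real.exp_le_one_iff, neg_nonpos]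
  exact Finset.sum_nonneg fun k _ => mul_nonneg (hu k) (hx k)

lemma integral_withDensity_ofReal {X : Type*} [MeasurableSpace X] {μ : Measure X} {g h : X → ℝ}
    (hg : AEMeasurable g μ) :
    ∫ x, h x ∂(μ.withDensity fun x => ENNReal.ofReal (g x)) = ∫ x, max (g x) 0 * h x ∂μ := by
  rw [integral_withDensity_eq_integral_toReal_smul₀ hg.ennreal_ofReal
    (.of_forall fun _ => ENNReal.ofReal_lt_top)]
  simp only [ENNReal.toReal_ofReal', smul_eq_mul]

/-- If the Laplace transform of a finite measure agrees for large arguments with that of a signed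
integrable density, then a shifted version of the measure and of the density are related by the
uniqueness theorem. -/
lemma tilted_eq_of_laplace {μ L : Measure (Fin n → ℝ)} [IsFiniteMeasure μ]
    (hμ : ∀ᵐ x ∂μ, ∀ k, 0 ≤ x k) (hL : ∀ᵐ x ∂L, ∀ k, 0 ≤ x k) {f : (Fin n → ℝ) → ℝ}
    {v : Fin n → ℝ} (hv : ∀ k, 0 ≤ v k)
    (hint : Integrable (fun x => Real.exp (-∑ k, v k * x k) * f x) L)
    (hlap : ∀ u : Fin n → ℝ, (∀ k, v k ≤ u k) →
      ∫ x, Real.exp (-∑ k, u k * x k) * f x ∂L = ∫ x, Real.exp (-∑ k, u k * x k) ∂μ) :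
    μ.withDensity (fun x => ENNReal.ofReal (Real.exp (-∑ k, v k * x k))) +
        L.withDensity (fun x => ENNReal.ofReal (-(Real.exp (-∑ k, v k * x k) * f x))) =
      L.withDensity (fun x => ENNReal.ofReal (Real.exp (-∑ k, v k * x k) * f x)) := by
  have hw : Measurable fun x : Fin n → ℝ => Real.exp (-∑ k, v k * x k) := by fun_prop
  have hwi : Integrable (fun x => Real.exp (-∑ k, v k * x k)) μ := by
    refine Integrable.of_bound hw.aestronglyMeasurable 1 ?_
    filter_upwards [hμ] with x hx using exp_neg_sum_mul_le_one hv hx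
  have := isFiniteMeasure_withDensity_ofReal hwi.2
  have := isFiniteMeasure_withDensity_ofReal hint.2
  have hneg : Integrable (fun x => -(Real.exp (-∑ k, v k * x k) * f x)) L := hint.neg
  have := isFiniteMeasure_withDensity_ofReal hneg.2
  have hμ' := withDensity_absolutelyContinuous μ
    fun x => ENNReal.ofReal (Real.exp (-∑ k, v k * x k))
  have hL₁ := withDensity_absolutelyContinuous L
    fun x => ENNReal.ofReal (Real.exp (-∑ k, v k * x k) * f x)
  have hL₂ := withDensity_absolutelyContinuous L
    fun x => ENNReal.ofReal (-(Real.exp (-∑ k, v k * x k) * f x))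
  refine ext_of_laplace (ae_add_measure_iff.2 ⟨hμ'.ae_le hμ, hL₂.ae_le hL⟩) (hL₁.ae_le hL)
    fun u hu => ?_
  have hh : Measurable fun x : Fin n → ℝ => Real.exp (-∑ k, u k * x k) := by fun_prop
  have hbd : ∀ ρ : Measure (Fin n → ℝ), IsFiniteMeasure ρ → (∀ᵐ x ∂ρ, ∀ k, 0 ≤ x k) →
      Integrable (fun x => Real.exp (-∑ k, u k * x k)) ρ := fun ρ _ hρ => by
    refine Integrable.of_bound hh.aestronglyMeasurable 1 ?_
    filter_upwards [hρ] with x hx using exp_neg_sum_mul_le_one hu hx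
  -- Positive part minus negative part restores the weighted f, and the weight shifts the argument
  -- to v + u, where `hlap` applies.
  rw [integral_add_measure (hbd _ inferInstance (hμ'.ae_le hμ))
    (hbd _ inferInstance (hL₂.ae_le hL)),
    integral_withDensity_ofReal hw.aemeasurable, integral_withDensity_ofReal hint.1.aemeasurable,
    integral_withDensity_ofReal hneg.1.aemeasurable, ← eq_sub_iff_add_eq, ← integral_sub]
  · have hexp : ∀ x : Fin n → ℝ, Real.exp (-∑ k, v k * x k) * Real.exp (-∑ k, u k * x k) =
        Real.exp (-∑ k, (v k + u k) * x k) := fun x => by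
      rw [← Real.exp_add]
      simp only [add_mul, Finset.sum_add_distrib, neg_add]
    have h1 : ∀ x : Fin n → ℝ, max (Real.exp (-∑ k, v k * x k)) 0 * Real.exp (-∑ k, u k * x k) =
        Real.exp (-∑ k, (v k + u k) * x k) := fun x => by
      rw [max_eq_left (Real.exp_pos _).le, hexp]
    have h2 : ∀ x : Fin n → ℝ,
        max (Real.exp (-∑ k, v k * x k) * f x) 0 * Real.exp (-∑ k, u k * x k) -
          max (-(Real.exp (-∑ k, v k * x k) * f x)) 0 * Real.exp (-∑ k, u k * x k) =
        Real.exp (-∑ k, (v k + u k) * x k) * f x := fun x => by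
      rw [← hexp, ← sub_mul]
      have : ∀ y : ℝ, max y 0 - max (-y) 0 = y := fun y => by
        rcases le_total 0 y with hy | hy
        · rw [max_eq_left hy, max_eq_right (neg_nonpos.2 hy), sub_zero]
        · rw [max_eq_right hy, max_eq_left (neg_nonneg.2 hy)]; ring
      rw [this]; ring
    simp only [h1, h2]
    exact (hlap (fun k => v k + u k) fun k => le_add_of_nonneg_right (hu k)).symm
  · refine hint.pos_part.mul_bdd (c := 1) hh.aestronglyMeasurable ?_
    filter_upwards [hL] with x hx using exp_neg_sum_mul_le_one hu hx
  · refine hneg.pos_part.mul_bdd (c := 1) hh.aestronglyMeasurable ?_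
    filter_upwards [hL] with x hx using exp_neg_sum_mul_le_one hu hx

/-- A continuous function on the open orthant whose Laplace transform agrees for large arguments
with that of a finite measure is a nonnegative density of this measure. -/
lemma density_of_laplace {μ : Measure (Fin n → ℝ)} [IsFiniteMeasure μ]
    (hμ : ∀ᵐ x ∂μ, ∀ k, 0 ≤ x k) {f : (Fin n → ℝ) → ℝ}
    (hf : ContinuousOn f {x | ∀ k, 0 < x k}) {v : Fin n → ℝ} (hv : ∀ k, 0 ≤ v k)
    (hint : IntegrableOn (fun x => Real.exp (-∑ k, v k * x k) * f x) {x | ∀ k, 0 < x k})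
    (hlap : ∀ u : Fin n → ℝ, (∀ k, v k ≤ u k) →
      ∫ x in {x : Fin n → ℝ | ∀ k, 0 < x k}, Real.exp (-∑ k, u k * x k) * f x =
        ∫ x, Real.exp (-∑ k, u k * x k) ∂μ) :
    (∀ x : Fin n → ℝ, (∀ k, 0 < x k) → 0 ≤ f x) ∧
      μ = (volume.restrict {x : Fin n → ℝ | ∀ k, 0 < x k}).withDensity
        fun x => ENNReal.ofReal (f x) := by
  set U : Set (Fin n → ℝ) := {x | ∀ k, 0 < x k} with hU
  have hUo : IsOpen U := isOpen_posOrthant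
  have hUm : MeasurableSet U := hUo.measurableSet
  have hfm : AEMeasurable f (volume.restrict U) := hf.aemeasurable hUm
  have hL : ∀ᵐ x ∂(volume.restrict U), ∀ k, 0 ≤ x k :=
    (ae_restrict_iff' hUm).2 (.of_forall fun x hx k => (hx k).le)
  set w : (Fin n → ℝ) → ℝ := fun x => Real.exp (-∑ k, v k * x k) with hw
  have key : μ.withDensity (fun x => ENNReal.ofReal (w x)) +
      (volume.restrict U).withDensity (fun x => ENNReal.ofReal (-(w x * f x))) =
      (volume.restrict U).withDensity fun x => ENNReal.ofReal (w x * f x) :=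
    tilted_eq_of_laplace hμ hL hv hint hlap
  have hwm : Measurable w := by fun_prop
  have hwf : AEMeasurable (fun x => w x * f x) (volume.restrict U) := hwm.aemeasurable.mul hfm
  have hwf' : AEMeasurable (fun x => -(w x * f x)) (volume.restrict U) := hwf.neg
  have hwpos : ∀ x, 0 < w x := fun x => Real.exp_pos _
  have hnonneg : ∀ x ∈ U, 0 ≤ f x := by
    -- On `N` the right side of `key` has no mass, so neither has the negative part; its density is
    -- positive there, so the open set `N` is null and hence empty.
    set N : Set (Fin n → ℝ) := U ∩ f ⁻¹' Iio 0 with hN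
    have hNo : IsOpen N := hf.isOpen_inter_preimage hUo isOpen_Iio
    have hz : ((volume.restrict U).withDensity fun x => ENNReal.ofReal (w x * f x)) N = 0 := by
      rw [withDensity_apply _ hNo.measurableSet]
      exact setLIntegral_eq_zero hNo.measurableSet fun x hx =>
        ENNReal.ofReal_of_nonpos (mul_nonpos_of_nonneg_of_nonpos (hwpos x).le (le_of_lt hx.2))
    have hz' : ((volume.restrict U).withDensity fun x => ENNReal.ofReal (-(w x * f x))) N = 0 := by
      have h := congrArg (fun ρ : Measure (Fin n → ℝ) => ρ N) key
      simp only [Measure.add_apply, hz] at h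
      exact (add_eq_zero.1 h).2
    rw [withDensity_apply_eq_zero' hwf'.ennreal_ofReal,
      inter_eq_right.2, Measure.restrict_apply hNo.measurableSet,
      inter_eq_left.2 inter_subset_left, hNo.measure_eq_zero_iff (μ := volume)] at hz'
    · intro x hx
      by_contra! hneg
      exact (hz' ▸ (⟨hx, hneg⟩ : x ∈ N) : x ∈ (∅ : Set (Fin n → ℝ)))
    · intro x hx
      have hpos : 0 < -(w x * f x) := neg_pos.2 (mul_neg_of_pos_of_neg (hwpos x) hx.2)
      exact (ENNReal.ofReal_pos.2 hpos).ne'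
  refine ⟨hnonneg, ?_⟩
  have hneg0 : ((volume.restrict U).withDensity fun x => ENNReal.ofReal (-(w x * f x))) = 0 := by
    refine (withDensity_congr_ae ?_).trans withDensity_zero
    refine (ae_restrict_iff' hUm).2 (.of_forall fun x hx => ?_)
    exact ENNReal.ofReal_of_nonpos (neg_nonpos.2 (mul_nonneg (hwpos x).le (hnonneg x hx)))
  rw [hneg0, add_zero] at key
  -- The weight is positive and finite everywhere, so it can be divided out of both sides.
  rw [← withDensity_inv_same (μ := μ) hwm.ennreal_ofReal
    (.of_forall fun x => (ENNReal.ofReal_pos.2 (hwpos x)).ne')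
    (.of_forall fun x => ENNReal.ofReal_ne_top), key,
    ← withDensity_mul₀ hwf.ennreal_ofReal hwm.ennreal_ofReal.fun_inv.aemeasurable]
  congr 1
  ext x
  have h0 := (ENNReal.ofReal_pos.2 (hwpos x)).ne'
  rw [Pi.mul_apply, ENNReal.ofReal_mul (hwpos x).le, mul_comm, ← mul_assoc,
    ENNReal.inv_mul_cancel h0 ENNReal.ofReal_ne_top, one_mul]

end Density
-- Density and marginals of the feed-forward law
section FeedForwardDensity
variable {n : ℕ} {p : Fin (n + 1) → ℕ}
  {C : ∀ i : Fin n, Matrix (Fin (p i.castSucc)) (Fin (p i.castSucc)) ℝ}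
  {D : ∀ i : Fin n, Matrix (Fin (p i.castSucc)) (Fin (p i.succ)) ℝ} {π : Fin (p 0) → ℝ}
  {α : Fin n → ℝ}

/-- Continuity is what makes the set where the density is negative open. It is claimed on the open
orthant only, since x^{α−1} is singular at 0 when α < 1. -/
lemma continuousOn_productDensity (hα : ∀ i, 0 < α i) :
    ContinuousOn (productDensity α C D π) {x | ∀ k, 0 < x k} := by
  unfold productDensity
  simp only [dotProduct_chainProd_mulVec]
  refine continuousOn_finsetSum _ fun c _ => (continuousOn_const.mul ?_).mul continuousOn_const
  refine continuousOn_finsetProd _ fun i _ => ?_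
  exact (continuousOn_mlKernel (hα i) (C i) (D i) (c i.castSucc) (c i.succ)).comp
    (continuous_apply i).continuousOn fun x hx => hx i

/-- The Laplace transform of the product density, for large arguments. -/
lemma productDensity_laplace (hα : ∀ i, 0 < α i) {r : Fin n → ℝ} (hr : ∀ i, 0 < r i)
    (hC : ∀ i k a b, |(C i ^ k) a b| ≤ r i ^ k) {u : Fin n → ℝ} (hu : ∀ i, 0 < u i)
    (hru : ∀ i, r i < u i ^ α i) :
    IntegrableOn (fun x => Real.exp (-∑ k, u k * x k) * productDensity α C D π x)
      {x | ∀ k, 0 < x k} ∧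
    ∫ x in {x : Fin n → ℝ | ∀ k, 0 < x k},
      Real.exp (-∑ k, u k * x k) * productDensity α C D π x = productLaplace α C D π u := by
  -- Along a fixed path the integrand is a product of functions of single coordinates, ready for
  -- Fubini.
  have heq : ∀ x : Fin n → ℝ, Real.exp (-∑ k, u k * x k) * productDensity α C D π x =
      ∑ c : ∀ k, Fin (p k), π (c 0) * ∏ i, (Real.exp (-(u i * x i)) *
        (x i ^ (α i - 1) • (mittagLeffler (α i) (α i) (x i ^ α i • C i) * D i))
          (c i.castSucc) (c i.succ)) := by
    intro x
    rw [productDensity, dotProduct_chainProd_mulVec, Finset.mul_sum]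
    refine Finset.sum_congr rfl fun c _ => ?_
    rw [Finset.prod_mul_distrib, ← Real.exp_sum, Finset.sum_neg_distrib, Pi.one_apply]
    ring
  have hlap := fun i => mlKernel_laplace (hα i) (hr i) (hC i) (hu i) (hru i) (D i)
  have hint : ∀ c : ∀ k, Fin (p k), Integrable (fun x : Fin n → ℝ => π (c 0) *
      ∏ i, (Real.exp (-(u i * x i)) *
        (x i ^ (α i - 1) • (mittagLeffler (α i) (α i) (x i ^ α i • C i) * D i))
          (c i.castSucc) (c i.succ))) (Measure.pi fun _ => volume.restrict (Ioi (0 : ℝ))) :=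
    fun c => (Integrable.fintype_prod fun i => (hlap i (c i.castSucc) (c i.succ)).1).const_mul _
  rw [IntegrableOn, volume_restrict_posOrthant]
  simp only [heq]
  refine ⟨integrable_finsetSum _ fun c _ => hint c, ?_⟩
  rw [integral_finsetSum _ fun c _ => hint c, productLaplace, dotProduct_chainProd_mulVec]
  refine Finset.sum_congr rfl fun c _ => ?_
  rw [integral_const_mul, integral_fintype_prod_eq_prod
    (f := fun i t => Real.exp (-(u i * t)) *
      (t ^ (α i - 1) • (mittagLeffler (α i) (α i) (t ^ α i • C i) * D i))
        (c i.castSucc) (c i.succ)), Pi.one_apply, mul_one]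
  exact congrArg _ (Finset.prod_congr rfl fun i _ => (hlap i _ _).2)

/-- A nonnegative random vector whose Laplace transform is the product form has the product
density. -/
lemma hasPositiveDensity_of_laplace (hα : ∀ i, 0 < α i) {Ω : Type*} [MeasurableSpace Ω]
    {P : Measure Ω} [IsProbabilityMeasure P] {X : Ω → Fin n → ℝ} (hX : AEMeasurable X P)
    (hX0 : ∀ᵐ ω ∂P, ∀ k, 0 ≤ X ω k)
    (hlap : ∀ u : Fin n → ℝ, (∀ i, 0 ≤ u i) →
      ∫ ω, Real.exp (-∑ i, u i * X ω i) ∂P = productLaplace α C D π u) :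
    HasPositiveDensity (productDensity α C D π) X P := by
  choose r hr hC using fun i => exists_pow_apply_le (C i)
  -- The threshold satisfies v_i^{α_i} = r_i + 1 > r_i, so all Neumann series converge from v
  -- onwards.
  set v : Fin n → ℝ := fun i => (r i + 1) ^ (α i)⁻¹ with hv
  have hv0 : ∀ i, 0 < v i := fun i => Real.rpow_pos_of_pos (by linarith [hr i]) _
  have hvr : ∀ u : Fin n → ℝ, (∀ i, v i ≤ u i) → ∀ i, r i < u i ^ α i := fun u hu i => by
    have h1 : v i ^ α i = r i + 1 := by
      rw [hv, ← Real.rpow_mul (by linarith [hr i]), inv_mul_cancel₀ (hα i).ne', Real.rpow_one]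
    have h2 := Real.rpow_le_rpow (hv0 i).le (hu i) (hα i).le
    linarith
  have := Measure.isProbabilityMeasure_map hX
  have hset : MeasurableSet {x : Fin n → ℝ | ∀ k, 0 ≤ x k} := by
    simp only [ofPred_forall]
    exact .iInter fun k => measurableSet_le measurable_const (measurable_pi_apply k)
  have hμ : ∀ᵐ x ∂(P.map X), ∀ k, 0 ≤ x k := (ae_map_iff hX hset).2 hX0
  have hcont := continuousOn_productDensity (C := C) (D := D) (π := π) hα
  obtain ⟨h1, h2⟩ := density_of_laplace hμ hcont (fun k => (hv0 k).le)
    (productDensity_laplace hα hr hC hv0 (hvr v fun _ => le_rfl)).1 (fun u hu => by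
      have hu0 : ∀ i, 0 < u i := fun i => (hv0 i).trans_le (hu i)
      rw [(productDensity_laplace hα hr hC hu0 (hvr u hu)).2, ← hlap u fun i => (hu0 i).le,
        integral_map hX (Measurable.aestronglyMeasurable (by fun_prop))])
  exact ⟨hX, hcont.aemeasurable isOpen_posOrthant.measurableSet, h1, h2⟩

lemma IsFeedForward.isMML_marginal (h : IsFeedForward C D π) (hα : ∀ i, 0 < α i ∧ α i ≤ 1)
    {Ω : Type*} [MeasurableSpace Ω] {P : Measure Ω} {X : Ω → Fin n → ℝ} (hX : AEMeasurable X P)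
    (hX0 : ∀ᵐ ω ∂P, ∀ k, 0 ≤ X ω k)
    (hlap : ∀ u : Fin n → ℝ, (∀ i, 0 ≤ u i) →
      ∫ ω, Real.exp (-∑ i, u i * X ω i) ∂P = productLaplace α C D π u) (i : Fin n) :
    IsMML (α i) (marginalInit C D π i) (C i) (fun ω => X ω i) P where
  alpha_pos := (hα i).1
  alpha_le_one := (hα i).2
  rep := h.isPhaseTypeRep_marginal i
  aemeasurable := (measurable_pi_apply i).comp_aemeasurable hX
  nonneg := hX0.mono fun ω hω => hω i
  laplace v hv := by
    rw [← h.productLaplace_single (fun i => (hα i).1), ← hlap]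
    · congr 1
      ext ω
      rw [Finset.sum_eq_single i] <;> simp +contextual
    · intro j
      by_cases hj : j = i
      · subst hj; simpa using hv
      · simp [hj]

end FeedForwardDensity
end GMMLPaper

theorem theorem5p2 {n : ℕ} (hn : 0 < n) (p : Fin (n + 1) → ℕ)
    (C : ∀ i : Fin n, Matrix (Fin (p i.castSucc)) (Fin (p i.castSucc)) ℝ)
    (D : ∀ i : Fin n, Matrix (Fin (p i.castSucc)) (Fin (p i.succ)) ℝ)
    (π : Fin (p 0) → ℝ) (hFF : IsFeedForward C D π)
    (α : Fin n → ℝ) (hα : ∀ i, 0 < α i ∧ α i ≤ 1) :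
    -- the Laplace transform: the block form, and its equivalent product form
    (∀ u : Fin n → ℝ, (∀ i, 0 ≤ u i) →
      IsUnit (ffResolvent α C D u) ∧
      (∀ i, IsUnit (u i ^ α i • (1 : Matrix (Fin (p i.castSucc)) (Fin (p i.castSucc)) ℝ) - C i)) ∧
      gmmlLaplace α (ffInit π) (ffMatrix C D) (ffReward p) u =
        ffInit π ⬝ᵥ ((ffResolvent α C D u)⁻¹.mulVec (ffExit D)) ∧
      ffInit π ⬝ᵥ ((ffResolvent α C D u)⁻¹.mulVec (ffExit D)) = productLaplace α C D π u) ∧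
    -- the distribution of every random vector of this class
    (∀ {Ω : Type*} [MeasurableSpace Ω] (P : MeasureTheory.Measure Ω)
        [MeasureTheory.IsProbabilityMeasure P] (X : Ω → Fin n → ℝ),
      IsGMML α (ffInit π) (ffMatrix C D) (ffReward p) X P →
      (∀ u : Fin n → ℝ, (∀ i, 0 ≤ u i) →
        ∫ ω, Real.exp (-∑ i, u i * X ω i) ∂P = productLaplace α C D π u) ∧
      HasPositiveDensity (productDensity α C D π) X P ∧
      ∀ i : Fin n, IsMML (α i) (marginalInit C D π i) (C i) (fun ω => X ω i) P) := by
  refine ⟨fun u hu => ⟨hFF.isUnit_ffResolvent hu, fun i =>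
    (hFF.subIntensity i).isUnit_resolvent (Real.rpow_nonneg (hu i) _), hFF.gmmlLaplace_eq u,
    hFF.ffResolvent_inv_mulVec hn hu⟩, fun P _ X hX => ?_⟩
  have hlap : ∀ u : Fin n → ℝ, (∀ i, 0 ≤ u i) →
      ∫ ω, Real.exp (-∑ i, u i * X ω i) ∂P = productLaplace α C D π u := fun u hu => by
    rw [hX.laplace u hu, hFF.gmmlLaplace_eq, hFF.ffResolvent_inv_mulVec hn hu]
  exact ⟨hlap, hasPositiveDensity_of_laplace (fun i => (hα i).1) hX.aemeasurable hX.nonneg hlap,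
    hFF.isMML_marginal hα hX.aemeasurable hX.nonneg hlap⟩
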